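/- Consider a first-order language with no relation symbols other than equality, consisting of operation symbols (each of some finite arity $n\ge 1$) and constant symbols; constants are not counted as operations. An algebra is a nonempty structure for this language. An equation is called linear if each of its two sides contains at most one occurrence of operation symbols, that is, each side is a variable, a constant, or a term $f(w_1,\dots,w_n)$ where $f$ is an operation symbol and every $w_i$ is a variable or a constant. Let $\mathcal V$ be a variety axiomatized by a (possibly infinite) set of linear equations, that is, the class of all algebras satisfying all equations of this set. Suppose that the language of $\mathcal V$ contains exactly one constant $c$ (and arbitrarily many operations), and that $f(c,c,\dots,c)=c$ is valid in $\mathcal V$ for every operation symbol $f$. Then: 1. $\mathcal V$ has the joint embedding property: for all $\mathbf A,\mathbf B\in\mathcal V$ there is $\mathbf D\in\mathcal V$ such that both $\mathbf A$ and $\mathbf B$ embed in $\mathbf D$. 2. The class of finite algebras in $\mathcal V$ has the joint embedding property: for all finite $\mathbf A,\mathbf B\in\mathcal V$ there is a finite $\mathbf D\in\mathcal V$ such that both $\mathbf A$ and $\mathbf B$ embed in $\mathbf D$. 3. If the language is finite, or, more generally, if $\mathcal V$ contains only countably many finite algebras up to isomorphism, then the class of finite algebras in $\mathcal V$ has a Fraïssé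 limit: there is a countable (possibly finite) algebra $\mathbf M$ which is ultrahomogeneous (every embedding of a finitely generated subalgebra of $\mathbf M$ into $\mathbf M$ extends to an automorphism of $\mathbf M$) and such that the finitely generated algebras embeddable in $\mathbf M$ are exactly the finite algebras in $\mathcal V$. -/

import Mathlib

open FirstOrder FirstOrder.Language CategoryTheory

universe u v w

namespace LinearVariety

variable {L : FirstOrder.Language.{u, v}}

/-- An equation: an ordered pair of terms, in variables indexed by `ℕ`. -/
structure Equation (L : FirstOrder.Language.{u, v}) where
  lhs : L.Term ℕ
  rhs : L.Term ℕ

/-- The term is a variable or a constant symbol. -/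
def IsVarOrConst (t : L.Term ℕ) : Prop :=
  (∃ x : ℕ, t = Term.var x) ∨ ∃ c : L.Constants, t = c.term

/-- The term has at most one occurrence of operation symbols, where constants do not count as
operations: it is a variable, a constant, or `f(w₁, …, wₙ)` with `f` an operation of positive
arity and each `wᵢ` a variable or a constant. -/
def IsLinearTerm (t : L.Term ℕ) : Prop :=
  IsVarOrConst t ∨
    ∃ (n : ℕ) (f : L.Functions n) (w : Fin n → L.Term ℕ),
      0 < n ∧ (∀ i, IsVarOrConst (w i)) ∧ t = Term.func f w

/-- A linear equation: at most one occurrence of operation symbols on each side. -/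
def Equation.IsLinear (e : Equation L) : Prop :=
  IsLinearTerm e.lhs ∧ IsLinearTerm e.rhs

/-- The equation holds in the algebra `A` (under every assignment of the variables). -/
def Equation.HoldsIn (e : Equation L) (A : Type w) [L.Structure A] : Prop :=
  ∀ a : ℕ → A, e.lhs.realize a = e.rhs.realize a

/-- The equation is valid in the class `V`: it holds in every member of `V`. -/
def Equation.ValidIn (e : Equation L) (V : Set (Bundled.{w} L.Structure)) : Prop :=
  ∀ A ∈ V, e.HoldsIn A

/-- The variety axiomatized by the set `E` of equations: the class of all (nonempty) algebras
in which all the equations in `E` hold. -/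
def variety (E : Set (Equation L)) : Set (Bundled.{w} L.Structure) :=
  {A | Nonempty A ∧ ∀ e ∈ E, e.HoldsIn A}

/-- The finite members of a class of algebras. -/
def finiteMembers (V : Set (Bundled.{w} L.Structure)) : Set (Bundled.{w} L.Structure) :=
  {A | A ∈ V ∧ Finite A}

/-- `K` has only countably many members up to isomorphism. -/
def EssentiallyCountable (K : Set (Bundled.{w} L.Structure)) : Prop :=
  (Quotient.mk equivSetoid '' K).Countable

/-- The equation `f(c, …, c) = c`. -/
def idempotentAt (c : L.Constants) {n : ℕ} (f : L.Functions n) : Equation L :=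
  ⟨Term.func f fun _ => c.term, c.term⟩

/-- `K` has a Fraïssé limit: there is a countable ultrahomogeneous structure whose age, that is,
the class of all finitely generated structures embeddable in it, is `K`. (These are the conditions
in `FirstOrder.Language.IsFraisseLimit`, which is only available for languages with countably many
function symbols; no such restriction is made here.) -/
def HasFraisseLimit (K : Set (Bundled.{w} L.Structure)) : Prop :=
  ∃ M : Bundled.{w} L.Structure, Countable M ∧ L.IsUltrahomogeneous M ∧ L.age M = K

end LinearVariety

/-! Joint embedding: as `c` is idempotent for every operation, `a ↦ (a, c)` and `b ↦ (c, b)` embed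
`A` and `B` in `A × B`. Amalgamation rests on linearity: if `r` is any set retraction of an algebra
`P` onto a subset `S` containing the constants, the operations `r ∘ f` on `S` satisfy every linear
equation of `P` (`Equation.HoldsIn.retract`). An amalgam of `A` and `B` over `C` is such a retract
of `A × B × C`. A Fraïssé construction for classes of finite structures
(`hasFraisseLimit_of_finite`) then gives the limit. -/

namespace LinearVariety

variable {L : FirstOrder.Language.{u, v}}

/-! ### Fraïssé limits of classes of finite structures -/

section Fraisse

open Structure Substructure

variable {K : Set (Bundled.{w} L.Structure)}

/-- For a class `K` of finite structures with amalgamation and joint embedding, every `A ∈ K` embeds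
in some `B ∈ K` in which `Y` embeds and over which all embeddings into `A` of substructures of `Y`
extend to `Y`. -/
theorem exists_embedding_extending_substructures (hfin : ∀ M ∈ K, Finite M) (hp : Hereditary K)
    (jep : JointEmbedding K) (ap : Amalgamation K) {A Y : Bundled.{w} L.Structure}
    (hA : A ∈ K) (hY : Y ∈ K) :
    ∃ B ∈ K, ∃ g : A ↪[L] B, Nonempty (Y ↪[L] B) ∧
      ∀ (S : L.Substructure Y) (f : S ↪[L] A), ∃ h : Y ↪[L] B, h.comp S.subtype = g.comp f := by
  classical
  have := hfin A hA
  have := hfin Y hY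
  have hS (S : L.Substructure Y) : (⟨S, inferInstance⟩ : Bundled.{w} L.Structure) ∈ K :=
    hp Y hY ⟨Structure.FG.of_finite, ⟨S.subtype⟩⟩
  have : Finite (L.Substructure Y) := Finite.of_injective _ SetLike.coe_injective
  have (S : L.Substructure Y) : Finite (S ↪[L] A) := DFunLike.finite _
  have := Fintype.ofFinite (Σ S : L.Substructure Y, S ↪[L] A)
  -- Finiteness of `A` and `Y` leaves finitely many pairs, so they can be amalgamated one at a time.
  suffices H : ∀ T : Finset (Σ S : L.Substructure Y, S ↪[L] A),
      ∃ B ∈ K, ∃ g : A ↪[L] B, Nonempty (Y ↪[L] B) ∧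
        ∀ t ∈ T, ∃ h : Y ↪[L] B, h.comp t.1.subtype = g.comp t.2 by
    obtain ⟨B, hB, g, hYB, h⟩ := H Finset.univ
    exact ⟨B, hB, g, hYB, fun S f => h ⟨S, f⟩ (Finset.mem_univ _)⟩
  intro T
  induction T using Finset.induction_on with
  | empty =>
    obtain ⟨B, hB, ⟨g⟩, hYB⟩ := jep A hA Y hY
    exact ⟨B, hB, g, hYB, by simp⟩
  | insert t T _ ih =>
    obtain ⟨B, hB, g, ⟨e⟩, h⟩ := ih
    obtain ⟨Q, k, l, hQ, hkl⟩ :=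
      ap ⟨t.1, inferInstance⟩ Y B t.1.subtype (g.comp t.2) (hS t.1) hY hB
    refine ⟨Q, hQ, l.comp g, ⟨l.comp e⟩, fun s hs => ?_⟩
    rcases Finset.mem_insert.1 hs with rfl | hs
    · exact ⟨k, hkl.trans (Embedding.comp_assoc _ _ _).symm⟩
    · obtain ⟨m, hm⟩ := h s hs
      exact ⟨l.comp m, by rw [Embedding.comp_assoc, hm, Embedding.comp_assoc]⟩

theorem exists_seq_representatives (hn : K.Nonempty) (hc : EssentiallyCountable K) :
    ∃ Y : ℕ → Bundled.{w} L.Structure, (∀ n, Y n ∈ K) ∧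
      ∀ X ∈ K, ∃ n, Nonempty (X ≃[L] Y n) := by
  obtain ⟨F, hF⟩ := Set.Countable.exists_eq_range hc (hn.image _)
  have hFK (n : ℕ) : ∃ Y ∈ K, Quotient.mk equivSetoid Y = F n := by
    have : F n ∈ Set.range F := ⟨n, rfl⟩
    rwa [← hF] at this
  choose Y hYK hYF using hFK
  refine ⟨Y, hYK, fun X hX => ?_⟩
  obtain ⟨n, hn⟩ : Quotient.mk equivSetoid X ∈ Set.range F := hF ▸ Set.mem_image_of_mem _ hX
  exact ⟨n, Quotient.exact (hn.symm.trans (hYF n).symm)⟩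

/-- Fraïssé's theorem for classes of finite structures, in an arbitrary language. -/
theorem hasFraisseLimit_of_finite (hn : K.Nonempty) (hfin : ∀ M ∈ K, Finite M)
    (hc : EssentiallyCountable K) (hp : Hereditary K) (jep : JointEmbedding K)
    (ap : Amalgamation K) : HasFraisseLimit K := by
  obtain ⟨Y, hYK, hY⟩ := exists_seq_representatives hn hc
  choose P hPK g hYP hg using fun (A : K) (n : ℕ) =>
    exists_embedding_extending_substructures hfin hp jep ap A.2 (hYK n)
  -- Stage `n` treats `Y n.unpair.1`, so every representative recurs at arbitrarily late stages.
  let G : ℕ → K := Nat.rec ⟨Y 0, hYK 0⟩ fun n A => ⟨P A n.unpair.1, hPK A _⟩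
  let f : ∀ i j : ℕ, i ≤ j → (G i).val ↪[L] (G j).val :=
    DirectedSystem.natLERec fun n => g (G n) n.unpair.1
  let M := Language.DirectLimit (fun n => (G n).val) f
  let ι (n : ℕ) : (G n).val ↪[L] M := Language.DirectLimit.of L ℕ (fun n => (G n).val) f n
  have hι (n : ℕ) (x : (G n).val) : ι (n + 1) (g (G n) n.unpair.1 x) = ι n x := by
    have h1 : f n (n + 1) n.le_succ x = g (G n) n.unpair.1 x := by
      simp only [f, DirectedSystem.coe_natLERec]
      exact Nat.leRecOn_succ' _
    rw [← h1]
    exact Language.DirectLimit.of_f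
  have hιle {i j : ℕ} (hij : i ≤ j) (x : (G i).val) : ι j (f i j hij x) = ι i x :=
    Language.DirectLimit.of_f
  have hMfin (n : ℕ) : Finite (G n).val := hfin _ (G n).2
  have hcount : Countable M := by
    have hs : Function.Surjective (fun x : Σ n, (G n).val => ι x.1 x.2) := fun z => by
      obtain ⟨i, x, h⟩ := Language.DirectLimit.exists_of z
      exact ⟨⟨i, x⟩, h⟩
    exact hs.countable
  have hage : L.age M = K := by
    refine (age_directLimit (fun n => (G n).val) f).trans (subset_antisymm
      (Set.iUnion_subset fun n => hp _ (G n).2) fun X hX => ?_)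
    have := hfin X hX
    obtain ⟨k, ⟨e⟩⟩ := hY X hX
    obtain ⟨n, rfl⟩ : ∃ n : ℕ, n.unpair.1 = k := ⟨Nat.pair k 0, by simp⟩
    obtain ⟨e'⟩ := hYP (G n) n.unpair.1
    exact Set.mem_iUnion_of_mem (n + 1) ⟨Structure.FG.of_finite, ⟨e'.comp e.toEmbedding⟩⟩

  refine ⟨⟨M, inferInstance⟩, hcount, ?_, hage⟩
  refine (isUltrahomogeneous_iff_IsExtensionPair (M := M) Structure.cg_of_countable).2 ?_
  -- By back-and-forth, one-point extensions suffice.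
  rw [isExtensionPair_iff_exists_embedding_closure_singleton_sup]
  intro S hS φ m
  let S' : L.Substructure M := closure L {m} ⊔ S
  have hS'K : (⟨S', inferInstance⟩ : Bundled.{w} L.Structure) ∈ K := by
    exact hage.le
      ⟨(fg_iff_structure_fg _).1 ((fg_closure_singleton m).sup hS), ⟨S'.subtype⟩⟩
  obtain ⟨k, ⟨e⟩⟩ := hY _ hS'K
  obtain ⟨i, T, hT⟩ := Language.DirectLimit.exists_fg_substructure_in_Sigma φ.toHom.range
    (FG.range ((fg_iff_structure_fg _).1 hS) φ.toHom)
  -- A stage that already contains the image of `φ` and treats the isomorphism type of `S'`.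
  obtain ⟨n, hin, rfl⟩ : ∃ n : ℕ, i ≤ n ∧ n.unpair.1 = k :=
    ⟨Nat.pair k i, Nat.right_le_pair k i, by simp⟩
  have hφ (s : S) : φ s ∈ (ι n).toHom.range := by
    have : φ s ∈ T.map (ι i).toHom := hT ▸ ⟨s, rfl⟩
    obtain ⟨x, -, hx⟩ := this
    exact ⟨f i n hin x, (hιle hin x).trans hx⟩
  let φ' : S ↪[L] (G n).val :=
    (ι n).equivRange.symm.toEmbedding.comp (φ.codRestrict _ hφ)
  have hφ' (s : S) : ι n (φ' s) = φ s := by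
    have := congrArg Subtype.val
      ((ι n).equivRange.apply_symm_apply (φ.codRestrict _ hφ s))
    exact this
  let inc : S ↪[L] Y n.unpair.1 := e.toEmbedding.comp (Substructure.inclusion le_sup_right)
  obtain ⟨h, hh⟩ := hg (G n) n.unpair.1 inc.toHom.range
    (φ'.comp inc.equivRange.symm.toEmbedding)
  have hinc (s : S) : h (inc s) = g (G n) n.unpair.1 (φ' s) := by
    exact (DFunLike.congr_fun hh (inc.equivRange s)).trans
      (congrArg (fun x => g (G n) n.unpair.1 (φ' x)) (inc.equivRange.symm_apply_apply s))
  refine ⟨(ι (n + 1)).comp (h.comp e.toEmbedding), ?_⟩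
  ext s
  exact ((congrArg (ι (n + 1)) (hinc s)).trans ((hι n _).trans (hφ' s))).symm

end Fraisse
-- Counting finite algebras in a finite language
section Countability

open Structure

theorem finite_structure [L.IsAlgebraic] [Finite L.Symbols] (X : Type w) [Finite X] :
    Finite (L.Structure X) := by
  have : Finite (Σ n, L.Functions n) := Finite.sum_left (Σ n, L.Relations n)
  refine Finite.of_injective
    (β := ∀ s : Σ n, L.Functions n, (Fin s.1 → X) → X)
    (fun S s => S.funMap s.2) fun S T h => ?_
  ext n s x
  · exact congrFun (congrFun h ⟨n, s⟩) x
  · exact isEmptyElim s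

theorem essentiallyCountable_of_finite_symbols [L.IsAlgebraic] [Finite L.Symbols]
    (K : Set (Bundled.{w} L.Structure)) (hfin : ∀ M ∈ K, Finite M) : EssentiallyCountable K := by
  have (n : ℕ) : Countable (L.Structure (ULift.{w} (Fin n))) :=
    have := finite_structure (L := L) (ULift.{w} (Fin n))
    Finite.to_countable
  refine (Set.countable_range fun s : Σ n : ℕ, L.Structure (ULift.{w} (Fin n)) =>
    Quotient.mk equivSetoid (⟨_, s.2⟩ : Bundled.{w} L.Structure)).mono ?_
  rintro _ ⟨M, hM, rfl⟩
  have := hfin M hM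
  obtain ⟨n, ⟨e⟩⟩ := Finite.exists_equiv_fin M
  let e' : M ≃ ULift.{w} (Fin n) := e.trans Equiv.ulift.symm
  exact ⟨⟨n, e'.inducedStructure⟩, Quotient.sound ⟨(Equiv.bundledInducedEquiv L e').symm⟩⟩

end Countability

/-! ### Products, retracts and amalgams in linear varieties -/

section Variety

open Structure

variable {E : Set (Equation L)}

theorem Equation.HoldsIn.of_embedding {e : Equation L} {A B : Type*} [L.Structure A]
    [L.Structure B] (h : e.HoldsIn B) (f : A ↪[L] B) : e.HoldsIn A := fun a =>
  f.injective <| by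
    rw [← HomClass.realize_term f, ← HomClass.realize_term f]
    exact h _

theorem hereditary_finiteMembers_variety (c : L.Constants) :
    Hereditary (finiteMembers (variety.{u, v, w} E)) := by
  rintro M ⟨⟨-, hM⟩, _⟩ N ⟨-, ⟨f⟩⟩
  exact ⟨⟨⟨(c : N)⟩, fun e he => (hM e he).of_embedding f⟩, Finite.of_injective f f.injective⟩

/-- The direct product of two structures. -/
instance prodStructure (A B : Type*) [L.Structure A] [L.Structure B] : L.Structure (A × B) where
  funMap f x := (funMap f fun i => (x i).1, funMap f fun i => (x i).2)
  RelMap r x := (RelMap r fun i => (x i).1) ∧ RelMap r fun i => (x i).2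

section Product

variable {A B : Type*} [L.Structure A] [L.Structure B]

theorem realize_prod {α : Type*} (t : L.Term α) (a : α → A × B) :
    t.realize a = (t.realize fun x => (a x).1, t.realize fun x => (a x).2) := by
  induction t with
  | var x => rfl
  | func f ts ih => simp only [Term.realize_func, ih]; rfl

theorem Equation.HoldsIn.prod {e : Equation L} (hA : e.HoldsIn A) (hB : e.HoldsIn B) :
    e.HoldsIn (A × B) := fun a => by
  rw [realize_prod, realize_prod, hA, hB]

end Product

/-- The structure induced on a set `S` by a retraction onto it. -/
abbrev retractStructure [L.IsAlgebraic] {P : Type*} [L.Structure P] (S : Set P) (r : P → S) :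
    L.Structure S where
  funMap f x := r (funMap f fun i => (x i : P))
  RelMap R := isEmptyElim R

section Retract

variable [L.IsAlgebraic] {P : Type*} [L.Structure P] {S : Set P} {r : P → S}

theorem realize_retract_of_isVarOrConst (hr : ∀ s : S, r s = s)
    (hS : ∀ d : L.Constants, (d : P) ∈ S) {t : L.Term ℕ} (ht : IsVarOrConst t) (a : ℕ → S) :
    ((@Term.realize L S (retractStructure S r) ℕ a t : S) : P) = t.realize fun n => (a n : P) := by
  rcases ht with ⟨x, rfl⟩ | ⟨d, rfl⟩
  · rfl
  · rw [Term.realize_constants (M := P)]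
    refine Eq.trans ?_ (congrArg Subtype.val (hr ⟨_, hS d⟩))
    exact congrArg (fun x => ((r (funMap d x) : S) : P)) (Subsingleton.elim _ _)

/-- With at most one operation symbol, `r` acts only once, at the outside; nested operations would
put `r` inside the term. Hence `r` need not be a homomorphism. -/
theorem realize_retract_of_isLinearTerm (hr : ∀ s : S, r s = s)
    (hS : ∀ d : L.Constants, (d : P) ∈ S) {t : L.Term ℕ} (ht : IsLinearTerm t) (a : ℕ → S) :
    @Term.realize L S (retractStructure S r) ℕ a t = r (t.realize fun n => (a n : P)) := by
  rcases ht with ht | ⟨n, f, w, -, hw, rfl⟩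
  · rw [← realize_retract_of_isVarOrConst hr hS ht, hr]
  · exact congrArg (fun x => r (funMap f x))
      (funext fun i => realize_retract_of_isVarOrConst hr hS (hw i) a)

/-- Linear equations are inherited by retracts containing the constants. -/
theorem Equation.HoldsIn.retract {e : Equation L} (he : e.HoldsIn P) (hl : e.IsLinear)
    (hr : ∀ s : S, r s = s) (hS : ∀ d : L.Constants, (d : P) ∈ S) :
    @Equation.HoldsIn L e S (retractStructure S r) := fun a => by
  rw [realize_retract_of_isLinearTerm hr hS hl.1, realize_retract_of_isLinearTerm hr hS hl.2, he]

end Retract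

theorem amalgamation_finiteMembers_variety [L.IsAlgebraic] (hE : ∀ e ∈ E, e.IsLinear) :
    Amalgamation (finiteMembers (variety.{u, v, w} E)) := by
  classical
  rintro C A B i j ⟨⟨⟨c₀⟩, hC⟩, _⟩ ⟨⟨-, hA⟩, _⟩ ⟨⟨-, hB⟩, _⟩
  -- `ρ` and `σ` are mere set maps, left inverse to `i` and `j`.
  let ρ : A → C := Function.extend i id fun _ => c₀
  let σ : B → C := Function.extend j id fun _ => c₀
  have hρ (x : C) : ρ (i x) = x := i.injective.extend_apply id _ x
  have hσ (x : C) : σ (j x) = x := j.injective.extend_apply id _ x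
  let α : A → A × B × C := fun a => (a, j (ρ a), ρ a)
  let β : B → A × B × C := fun b => (i (σ b), b, σ b)
  have hαβ (x : C) : α (i x) = β (j x) := by simp [α, β, hρ, hσ]
  let S : Set (A × B × C) := Set.range α ∪ Set.range β
  let αS : A → S := fun a => ⟨α a, Or.inl ⟨a, rfl⟩⟩
  let βS : B → S := fun b => ⟨β b, Or.inr ⟨b, rfl⟩⟩
  -- The two cases agree on their overlap `(i z, j z, z)` since `α (i z) = β (j z)`; the last value
  -- is arbitrary.
  let r : A × B × C → S := fun p =>
    if p.2.1 = j p.2.2 then αS p.1 else if p.1 = i p.2.2 then βS p.2.1 else αS (i c₀)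
  have hrA (a : A) (z : C) : r (a, j z, z) = αS a := if_pos rfl
  have hrB (b : B) (z : C) : r (i z, b, z) = βS b := by
    by_cases h : b = j z
    · subst h
      exact (hrA _ _).trans (Subtype.ext (hαβ z))
    · exact (if_neg h).trans (if_pos rfl)
  have hr (s : S) : r s = s := by
    obtain ⟨_, ⟨a, rfl⟩ | ⟨b, rfl⟩⟩ := s
    · exact hrA _ _
    · exact hrB _ _
  have hS (d : L.Constants) : (d : A × B × C) ∈ S := by
    refine Or.inl ⟨(d : A), ?_⟩
    have hi : i (d : C) = (d : A) := i.map_constants d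
    have hj : j (d : C) = (d : B) := j.map_constants d
    have h1 : ρ (d : A) = (d : C) := by rw [← hi, hρ]
    have h2 : (d : A × B × C) = ((d : A), (d : B), (d : C)) := by
      have := realize_prod (A := A) (B := B × C) (d.term (α := Empty)) default
      have := realize_prod (A := B) (B := C) (d.term (α := Empty)) default
      simp_all [Term.realize_constants]
    rw [h2]
    simp [α, h1, hj]
  let str : L.Structure S := retractStructure S r
  refine ⟨⟨S, str⟩, ⟨⟨αS, fun a b h => congrArg (fun s : S => s.1.1) h⟩, ?_, ?_⟩,
    ⟨⟨βS, fun a b h => congrArg (fun s : S => s.1.2.1) h⟩, ?_, ?_⟩, ⟨⟨⟨αS (i c₀)⟩, ?_⟩, ?_⟩, ?_⟩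
  · intro n f x
    -- The product operation applied to the tuples `α (x k)` gives some `(a, j z, z)` with `a =
    -- funMap f x`, which `r` sends to `α a` even if `z ≠ ρ a`.
    refine (hrA (funMap f x) (funMap f (ρ ∘ x))).symm.trans (congrArg r ?_)
    rw [j.map_fun]
    rfl
  · intro n R
    exact isEmptyElim R
  · intro n f x
    refine (hrB (funMap f x) (funMap f (σ ∘ x))).symm.trans (congrArg r ?_)
    rw [i.map_fun]
    rfl
  · intro n R
    exact isEmptyElim R
  · intro e he
    exact ((hA e he).prod ((hB e he).prod (hC e he))).retract (hE e he) hr hS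
  · exact Subtype.finite
  · exact DFunLike.ext _ _ fun x => Subtype.ext (hαβ x)

section JointEmbedding

variable {A B : Type*} [L.Structure A] [L.Structure B]

/-- The embedding of a factor into a product given by an idempotent element of the other one. -/
def embeddingProdLeft [L.IsAlgebraic] (b : B)
    (hb : ∀ (n : ℕ) (f : L.Functions n), funMap f (fun _ => b) = b) : A ↪[L] A × B where
  toFun a := (a, b)
  inj' _ _ h := congrArg Prod.fst h
  map_fun' f _ := Prod.ext rfl (hb _ f).symm
  map_rel' R := isEmptyElim R

/-- The embedding of a factor into a product given by an idempotent element of the other one. -/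
def embeddingProdRight [L.IsAlgebraic] (a : A)
    (ha : ∀ (n : ℕ) (f : L.Functions n), funMap f (fun _ => a) = a) : B ↪[L] A × B where
  toFun b := (a, b)
  inj' _ _ h := congrArg Prod.snd h
  map_fun' f _ := Prod.ext (ha _ f).symm rfl
  map_rel' R := isEmptyElim R

end JointEmbedding

theorem funMap_const_of_idempotentAt {c : L.Constants} (hc : ∀ d : L.Constants, d = c)
    {A : Type*} [L.Structure A]
    (hA : ∀ (n : ℕ) (f : L.Functions n), 0 < n → (idempotentAt c f).HoldsIn A)
    (n : ℕ) (f : L.Functions n) : funMap f (fun _ => (c : A)) = c := by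
  -- A nullary symbol is a constant, hence `c` itself.
  rcases Nat.eq_zero_or_pos n with rfl | hn
  · obtain rfl := hc f
    exact congrArg (funMap f) (Subsingleton.elim _ _)
  · simpa [idempotentAt, Term.realize_constants] using hA n f hn fun _ => (c : A)

theorem exists_prod_embeddings [L.IsAlgebraic] {c : L.Constants}
    (hc : ∀ d : L.Constants, d = c)
    (hcV : ∀ (n : ℕ) (f : L.Functions n), 0 < n →
      (idempotentAt c f).ValidIn (variety.{u, v, w} E))
    {A B : Bundled.{w} L.Structure} (hA : A ∈ variety E) (hB : B ∈ variety E) :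
    (⟨A × B, inferInstance⟩ : Bundled.{w} L.Structure) ∈ variety E ∧
      Nonempty (A ↪[L] A × B) ∧ Nonempty (B ↪[L] A × B) := by
  have h {A : Bundled.{w} L.Structure} (hA : A ∈ variety E) :=
    funMap_const_of_idempotentAt hc fun n f hn => hcV n f hn A hA
  exact ⟨⟨⟨(c : A), (c : B)⟩, fun e he => (hA.2 e he).prod (hB.2 e he)⟩,
    ⟨embeddingProdLeft _ (h hB)⟩, ⟨embeddingProdRight _ (h hA)⟩⟩

theorem finiteMembers_variety_nonempty [L.IsAlgebraic] :
    (finiteMembers (variety.{u, v, w} E)).Nonempty :=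
  ⟨⟨PUnit, ⟨fun _ _ => PUnit.unit, fun R => isEmptyElim R⟩⟩,
    ⟨⟨PUnit.unit⟩, fun _ _ _ => rfl⟩, inferInstanceAs (Finite PUnit)⟩

end Variety

end LinearVariety

theorem corollary4p6 (L : FirstOrder.Language.{u, v}) [L.IsAlgebraic]
    (E : Set (LinearVariety.Equation L)) (hE : ∀ e ∈ E, e.IsLinear)
    (V : Set (Bundled.{w} L.Structure)) (hV : V = LinearVariety.variety E)
    (c : L.Constants) (hc : ∀ d : L.Constants, d = c)
    (hcV : ∀ (n : ℕ) (f : L.Functions n), 0 < n → (LinearVariety.idempotentAt c f).ValidIn V) :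
    JointEmbedding V ∧
      JointEmbedding (LinearVariety.finiteMembers V) ∧
      ((Finite L.Symbols ∨ LinearVariety.EssentiallyCountable (LinearVariety.finiteMembers V)) →
        LinearVariety.HasFraisseLimit (LinearVariety.finiteMembers V)) := by
  subst hV
  have jep : JointEmbedding (LinearVariety.finiteMembers (LinearVariety.variety E)) := by
    rintro A ⟨hA, _⟩ B ⟨hB, _⟩
    obtain ⟨hP, hAP, hBP⟩ := LinearVariety.exists_prod_embeddings hc hcV hA hB
    exact ⟨_, ⟨hP, inferInstanceAs (Finite (A × B))⟩, hAP, hBP⟩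
  refine ⟨fun A hA B hB => ?_, jep, fun h => ?_⟩
  · obtain ⟨hP, hAP, hBP⟩ := LinearVariety.exists_prod_embeddings hc hcV hA hB
    exact ⟨_, hP, hAP, hBP⟩
  · refine LinearVariety.hasFraisseLimit_of_finite LinearVariety.finiteMembers_variety_nonempty
      (fun M hM => hM.2) ?_ (LinearVariety.hereditary_finiteMembers_variety c) jep
      (LinearVariety.amalgamation_finiteMembers_variety hE)
    rcases h with h | h
    · exact LinearVariety.essentiallyCountable_of_finite_symbols _ fun M hM => hM.2
    · exact h
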